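/- Let $G$ be a finite simple graph that is connected, with minimum degree at least $2$ and maximum degree $\Delta$. For a finite simple graph $H$ with at least two vertices, let $a(H)$ denote its algebraic connectivity, i.e. the second smallest eigenvalue (counted with multiplicity) of the Laplacian matrix $L(H)=D(H)-A(H)$, where $D(H)$ is the diagonal degree matrix and $A(H)$ the adjacency matrix of $H$. Let $s(H)$ denote the subdivision of $H$, i.e. the graph obtained from $H$ by replacing each edge $uv$ by a path $u\,w_{uv}\,v$ with one new internal vertex $w_{uv}$, and let $s^0(G)=G$ and $s^k(G)=s(s^{k-1}(G))$ for $k\ge 1$. Then, for every integer $k\ge 0$, \[ a(s^k(G))\ \ge\ \frac{\min\left\{\frac{2}{\Delta}\,a(G),\,8\right\}}{4^k}. \] -/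

import Mathlib

universe u

namespace SimpleGraph

/-- The algebraic connectivity (Laplacian spectral gap) `a(G)` of a finite graph `G`: the second
smallest eigenvalue, counted with multiplicity, of the Laplacian matrix `L(G) = D(G) - A(G)`.
Mathlib lists the eigenvalues of a Hermitian matrix of size `n` in decreasing order, at the indices
`0, …, n - 1`, so the second smallest one has index `n - 2`.
For graphs with fewer than two vertices there is no such eigenvalue and the value is set to `0`. -/
noncomputable def algebraicConnectivity {V : Type u} [Fintype V] (G : SimpleGraph V) : ℝ :=
  open Classical in
  if h : 2 ≤ Fintype.card V then
    (G.isHermitian_lapMatrix ℝ).eigenvalues₀ ⟨Fintype.card V - 2, by omega⟩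
  else 0

/-- The subdivision `s(G)` of `G`: every edge `e` of `G` is replaced by a path with one new internal
vertex. The vertices are those of `G` together with one new vertex per edge of `G`; the new vertex
`e` is adjacent exactly to the two ends of `e`, and there are no other edges. -/
def subdivision {V : Type u} (G : SimpleGraph V) : SimpleGraph (V ⊕ G.edgeSet) where
  Adj
    | Sum.inl v, Sum.inr e => v ∈ (e : Sym2 V)
    | Sum.inr e, Sum.inl v => v ∈ (e : Sym2 V)
    | _, _ => False
  symm := ⟨by rintro (v | e) (w | f) h <;> exact h⟩
  loopless := ⟨by rintro (v | e) h <;> exact h⟩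

end SimpleGraph

/-- A finite simple graph bundled with its vertex set; needed since the vertex set changes when
the subdivision is iterated. -/
structure FiniteGraph : Type (u + 1) where
  /-- The vertex set. -/
  V : Type u
  /-- The vertex set is finite. -/
  [fintypeV : Fintype V]
  /-- The graph. -/
  graph : SimpleGraph V

namespace FiniteGraph

attribute [instance] FiniteGraph.fintypeV

/-- The subdivision of a bundled finite graph. -/
noncomputable def subdivision (G : FiniteGraph.{u}) : FiniteGraph.{u} :=
  open Classical in
  { V := G.V ⊕ G.graph.edgeSet
    fintypeV := inferInstance
    graph := G.graph.subdivision }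

/-- The `k`-th iterated subdivision: `s⁰(G) = G` and `sᵏ⁺¹(G) = s(sᵏ(G))`. -/
noncomputable def iteratedSubdivision (G : FiniteGraph.{u}) : ℕ → FiniteGraph.{u}
  | 0 => G
  | k + 1 => (iteratedSubdivision G k).subdivision

end FiniteGraph

/-! The algebraic connectivity is traded for the spectral gap of the normalized Laplacian, which
behaves well under subdivision: two steps of the random walk on `s(G)`, started in `V`, form the
lazy walk on `G`, so a gap `c` becomes `1 - √(1 - c/2) ≥ c/4`. `DegreePoincare.subdivision` proves
this bound directly as a sum of squares.

Bounding degrees above by `Δ` gives the initial gap `c = a(G)/Δ`, and `c ≤ 2`. Subdivision keeps all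
degrees at least `2`, so returning to the unweighted inequality gains a factor `2`: `a(sᵏ(G)) ≥
2c/4ᵏ`. Leaving the centre `m` existential lets the same `m` serve `G` and `s(G)`. -/

/-! ### Sums over darts (each edge counted in both directions) -/

theorem SimpleGraph.sum_dart_eq {V : Type u} [Fintype V] (G : SimpleGraph V) [DecidableRel G.Adj]
    [Fintype G.Dart] (f : V → V → ℝ) :
    ∑ d : G.Dart, f d.fst d.snd = ∑ v, ∑ w, if G.Adj v w then f v w else 0 := by
  rw [← Fintype.sum_prod_type' (f := fun v w => if G.Adj v w then f v w else 0),
    ← Finset.sum_filter]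
  refine Finset.sum_bij (fun d _ => d.toProd) ?_ ?_ ?_ ?_
  · intro d _
    simp [d.adj]
  · intro a _ b _ h
    exact SimpleGraph.Dart.ext _ _ h
  · intro p hp
    exact ⟨⟨p, by simpa using hp⟩, Finset.mem_univ _, rfl⟩
  · intro d _
    rfl

theorem SimpleGraph.sum_dart_symm {V : Type u} (G : SimpleGraph V)
    [Fintype G.Dart] (f : G.Dart → ℝ) : ∑ d : G.Dart, f d.symm = ∑ d, f d :=
  Fintype.sum_bijective _ SimpleGraph.Dart.symm_involutive.bijective _ _ fun _ => rfl

theorem SimpleGraph.sum_dart_fst {V : Type u} [Fintype V] (G : SimpleGraph V) [DecidableRel G.Adj]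
    [Fintype G.Dart] (f : V → ℝ) :
    ∑ d : G.Dart, f d.fst = ∑ v, (G.degree v : ℝ) * f v := by
  rw [G.sum_dart_eq fun v _ => f v]
  refine Finset.sum_congr rfl fun v _ => ?_
  rw [← Finset.sum_filter, Finset.sum_const, nsmul_eq_mul, ← G.card_neighborFinset_eq_degree,
    G.neighborFinset_eq_filter]

theorem SimpleGraph.sum_dart_edge {V : Type u} [Fintype V] (G : SimpleGraph V)
    [Fintype G.Dart] [Fintype G.edgeSet] (f : G.edgeSet → ℝ) :
    ∑ d : G.Dart, f ⟨d.edge, d.edge_mem⟩ = 2 * ∑ e, f e := by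
  classical
  rw [← Finset.sum_fiberwise (s := Finset.univ) (g := fun d : G.Dart => (⟨d.edge, d.edge_mem⟩ : G.edgeSet)),
    Finset.mul_sum]
  refine Finset.sum_congr rfl fun e _ => ?_
  have h : ∀ d ∈ Finset.univ.filter (fun d : G.Dart => (⟨d.edge, d.edge_mem⟩ : G.edgeSet) = e),
      f ⟨d.edge, d.edge_mem⟩ = f e := by
    intro d hd
    rw [(Finset.mem_filter.1 hd).2]
  rw [Finset.sum_congr rfl h, Finset.sum_const, nsmul_eq_mul]
  congr 1
  have := G.dart_edge_fiber_card e.1 e.2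
  rw [← Nat.cast_ofNat, ← this]
  simp only [Subtype.ext_iff]
  norm_cast
  congr!

/-- A dart of `G` is the same as an incidence (start, edge), that is, an edge of `s(G)`, which
carries two darts. -/
theorem SimpleGraph.sum_dart_subdivision {V : Type u} (G : SimpleGraph V)
    [Fintype G.Dart] [Fintype G.subdivision.Dart] (f : V ⊕ G.edgeSet → V ⊕ G.edgeSet → ℝ) :
    ∑ d : G.subdivision.Dart, f d.fst d.snd =
      ∑ d : G.Dart, f (Sum.inl d.fst) (Sum.inr ⟨d.edge, d.edge_mem⟩) +
      ∑ d : G.Dart, f (Sum.inr ⟨d.edge, d.edge_mem⟩) (Sum.inl d.fst) := by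
  have hmem : ∀ d : G.Dart, d.fst ∈ d.edge := fun d => Sym2.mem_mk_left _ _
  let toDart : G.Dart ⊕ G.Dart → G.subdivision.Dart := Sum.elim
    (fun d => ⟨(Sum.inl d.fst, Sum.inr ⟨d.edge, d.edge_mem⟩), hmem d⟩)
    (fun d => ⟨(Sum.inr ⟨d.edge, d.edge_mem⟩, Sum.inl d.fst), hmem d⟩)
  have hinj : ∀ d d' : G.Dart, d.fst = d'.fst → d.edge = d'.edge → d = d' := by
    intro d d' h h'
    rcases (SimpleGraph.dart_edge_eq_iff d d').1 h' with h2 | h2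
    · exact h2
    · exfalso
      rw [h2] at h
      exact d'.adj.ne h.symm
  have hsurj : ∀ (v : V) (e : G.edgeSet), v ∈ (e : Sym2 V) →
      ∃ d : G.Dart, d.fst = v ∧ (⟨d.edge, d.edge_mem⟩ : G.edgeSet) = e := by
    rintro v ⟨e, he⟩ hv
    obtain ⟨w, rfl⟩ := hv
    exact ⟨⟨(v, w), he⟩, rfl, rfl⟩
  have hbij : Function.Bijective toDart := by
    constructor
    · rintro (d | d) (d' | d') h
      all_goals simp [toDart, SimpleGraph.Dart.ext_iff] at h
      · exact congrArg _ (hinj _ _ h.1 h.2)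
      · exact congrArg _ (hinj _ _ h.2 h.1)
    · rintro ⟨⟨v | e, w | f⟩, h⟩
      · exact h.elim
      · obtain ⟨d, h1, h2⟩ := hsurj v f h
        exact ⟨Sum.inl d, by simp [toDart, h1, h2]⟩
      · obtain ⟨d, h1, h2⟩ := hsurj w e h
        exact ⟨Sum.inr d, by simp [toDart, h1, h2]⟩
      · exact h.elim
  rw [← Fintype.sum_bijective toDart hbij (fun p => f (toDart p).fst (toDart p).snd) _
    (fun _ => rfl), Fintype.sum_sum_type]
  rfl

/-! ### The normalized gap under subdivision -/

/-- The Poincaré inequality for the degree measure: `c` is a lower bound for the spectral gap of the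
normalized Laplacian. -/
def SimpleGraph.DegreePoincare {V : Type u} [Fintype V] (G : SimpleGraph V) (c : ℝ) : Prop :=
  open Classical in
  ∀ x : V → ℝ, ∃ m : ℝ,
    c * ∑ d : G.Dart, (x d.fst - m) ^ 2 ≤ (∑ d : G.Dart, (x d.fst - x d.snd) ^ 2) / 2

theorem SimpleGraph.DegreePoincare.subdivision {V : Type u} [Fintype V] {G : SimpleGraph V}
    [Fintype (V ⊕ G.edgeSet)] {c : ℝ} (hc0 : 0 ≤ c) (hc2 : c ≤ 2) (h : G.DegreePoincare c) :
    G.subdivision.DegreePoincare (c / 4) := by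
  classical
  intro y
  obtain ⟨m, hm⟩ := h fun v => y (Sum.inl v)
  refine ⟨m, ?_⟩
  rw [G.sum_dart_subdivision fun p _ => (y p - m) ^ 2,
    G.sum_dart_subdivision fun p q => (y p - y q) ^ 2]
  set a : G.Dart → ℝ := fun d => y (Sum.inl d.fst) - m with ha
  set b : G.Dart → ℝ := fun d => y (Sum.inl d.snd) - m with hb
  set z : G.Dart → ℝ := fun d => y (Sum.inr ⟨d.edge, d.edge_mem⟩) - m with hz
  have hsymm : ∀ d : G.Dart, a d.symm = b d ∧ b d.symm = a d ∧ z d.symm = z d := by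
    intro d
    refine ⟨rfl, rfl, ?_⟩
    simp [z]
  have hb2 : ∑ d, b d ^ 2 = ∑ d, a d ^ 2 := by
    rw [← G.sum_dart_symm fun d => b d ^ 2]
    rfl
  have hbz : ∑ d, (b d - z d) ^ 2 = ∑ d, (a d - z d) ^ 2 := by
    rw [← G.sum_dart_symm fun d => (b d - z d) ^ 2]
    refine Finset.sum_congr rfl fun d _ => ?_
    rw [(hsymm d).2.1, (hsymm d).2.2]
  have hm' : c * ∑ d, a d ^ 2 ≤ (∑ d, (a d - b d) ^ 2) / 2 := by
    have e : ∑ d : G.Dart, (y (Sum.inl d.fst) - y (Sum.inl d.snd)) ^ 2 = ∑ d, (a d - b d) ^ 2 :=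
      Finset.sum_congr rfl fun d _ => by simp only [a, b]; ring
    rw [← e]
    exact hm
  have e1 : ∑ d : G.Dart, (y (Sum.inl d.fst) - y (Sum.inr ⟨d.edge, d.edge_mem⟩)) ^ 2 =
      ∑ d, (a d - z d) ^ 2 := Finset.sum_congr rfl fun d _ => by simp only [a, z]; ring
  have e2 : ∑ d : G.Dart, (y (Sum.inr ⟨d.edge, d.edge_mem⟩) - y (Sum.inl d.fst)) ^ 2 =
      ∑ d, (a d - z d) ^ 2 := Finset.sum_congr rfl fun d _ => by simp only [a, z]; ring
  rw [e1, e2]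
  change c / 4 * (∑ d, a d ^ 2 + ∑ d, z d ^ 2) ≤ _
  -- With `s = (a+b)/2`, `t = a-b`, `ζ = z-s`, right minus left is `c²t²/32 + (cs/2 - ζ)²/2 +
  -- (2-c)ζ²/4`. The multiplier `(1 + c/4)/4` of the inequality for `G` is chosen to complete this
  -- square.
  have hpt : ∀ d, c / 4 * ((a d ^ 2 + b d ^ 2) / 2 + z d ^ 2) ≤
      ((a d - z d) ^ 2 + (b d - z d) ^ 2) / 2
        - (1 + c / 4) / 4 * ((a d - b d) ^ 2 - c * (a d ^ 2 + b d ^ 2)) := by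
    intro d
    nlinarith [mul_nonneg (sq_nonneg c) (sq_nonneg (a d - b d)),
      sq_nonneg (c * (a d + b d) / 4 - (z d - (a d + b d) / 2)),
      mul_nonneg (sub_nonneg.2 hc2) (sq_nonneg (z d - (a d + b d) / 2))]
  have hsum := Finset.sum_le_sum fun d (_ : d ∈ Finset.univ) => hpt d
  simp only [Finset.sum_sub_distrib, ← Finset.mul_sum, Finset.sum_add_distrib,
    ← Finset.sum_div] at hsum
  rw [hb2, hbz] at hsum
  nlinarith [mul_nonneg (by positivity : 0 ≤ (1 + c / 4)) (sub_nonneg.2 hm')]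

/-! ### Variational characterization of the algebraic connectivity -/

theorem Matrix.IsHermitian.sum_dotProduct_eigenvectorBasis {ι : Type u} [Fintype ι]
    [DecidableEq ι] {A : Matrix ι ι ℝ} (hA : A.IsHermitian) (x y : ι → ℝ) :
    ∑ j, ((hA.eigenvectorBasis j).ofLp ⬝ᵥ x) * ((hA.eigenvectorBasis j).ofLp ⬝ᵥ y) = x ⬝ᵥ y := by
  have h := hA.eigenvectorBasis.sum_inner_mul_inner (WithLp.toLp 2 x) (WithLp.toLp 2 y)
  simp only [EuclideanSpace.inner_eq_star_dotProduct, star_trivial] at h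
  rw [dotProduct_comm x y, ← h]
  exact Finset.sum_congr rfl fun j _ => by rw [dotProduct_comm y]

theorem Matrix.IsHermitian.eigenvectorBasis_dotProduct_mulVec {ι : Type u} [Fintype ι]
    [DecidableEq ι] {A : Matrix ι ι ℝ} (hA : A.IsHermitian) (j : ι) (x : ι → ℝ) :
    (hA.eigenvectorBasis j).ofLp ⬝ᵥ A.mulVec x =
      hA.eigenvalues j * ((hA.eigenvectorBasis j).ofLp ⬝ᵥ x) := by
  have hT : A.transpose = A := by
    rw [← Matrix.conjTranspose_eq_transpose_of_trivial, hA.eq]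
  rw [Matrix.dotProduct_mulVec, ← Matrix.mulVec_transpose, hT, hA.mulVec_eigenvectorBasis,
    smul_dotProduct, smul_eq_mul]

theorem Matrix.IsHermitian.dotProduct_mulVec_eq_sum {ι : Type u} [Fintype ι]
    [DecidableEq ι] {A : Matrix ι ι ℝ} (hA : A.IsHermitian) (x : ι → ℝ) :
    x ⬝ᵥ A.mulVec x = ∑ j, hA.eigenvalues j * ((hA.eigenvectorBasis j).ofLp ⬝ᵥ x) ^ 2 := by
  rw [← hA.sum_dotProduct_eigenvectorBasis]
  refine Finset.sum_congr rfl fun j _ => ?_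
  rw [hA.eigenvectorBasis_dotProduct_mulVec]
  ring

theorem Matrix.IsHermitian.eigenvectorBasis_dotProduct {ι : Type u} [Fintype ι]
    [DecidableEq ι] {A : Matrix ι ι ℝ} (hA : A.IsHermitian) (i j : ι) :
    (hA.eigenvectorBasis i).ofLp ⬝ᵥ (hA.eigenvectorBasis j).ofLp = if i = j then 1 else 0 := by
  have h := orthonormal_iff_ite.1 hA.eigenvectorBasis.orthonormal i j
  rw [EuclideanSpace.inner_eq_star_dotProduct, star_trivial, dotProduct_comm] at h
  exact h

theorem SimpleGraph.dotProduct_lapMatrix_mulVec {V : Type u} [Fintype V] [DecidableEq V]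
    (G : SimpleGraph V) [DecidableRel G.Adj] [Fintype G.Dart] (x : V → ℝ) :
    x ⬝ᵥ (G.lapMatrix ℝ).mulVec x = (∑ d : G.Dart, (x d.fst - x d.snd) ^ 2) / 2 := by
  rw [← Matrix.toLinearMap₂'_apply', SimpleGraph.lapMatrix_toLinearMap₂',
    G.sum_dart_eq fun v w => (x v - x w) ^ 2]

theorem SimpleGraph.sum_sq_le_of_algebraicConnectivity {V : Type u} [Fintype V]
    (G : SimpleGraph V) [Fintype G.Dart] (x : V → ℝ) (hx : ∑ v, x v = 0) :
    G.algebraicConnectivity * ∑ v, x v ^ 2 ≤ (∑ d : G.Dart, (x d.fst - x d.snd) ^ 2) / 2 := by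
  classical
  have hE0 : 0 ≤ (∑ d : G.Dart, (x d.fst - x d.snd) ^ 2) / 2 := by positivity
  unfold SimpleGraph.algebraicConnectivity
  split_ifs with hcard
  swap
  · simpa using hE0
  set hA := G.isHermitian_lapMatrix ℝ
  -- If `a > 0`, every eigenvector except the last has a nonzero eigenvalue, hence is orthogonal to
  -- the kernel vector `1`. So `1` spans the last eigenline, and `x ⊥ 1` has no component there.
  by_cases hpos : hA.eigenvalues₀ ⟨Fintype.card V - 2, by omega⟩ ≤ 0
  · exact (mul_nonpos_of_nonpos_of_nonneg hpos (by positivity)).trans hE0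
  push Not at hpos
  set a := hA.eigenvalues₀ ⟨Fintype.card V - 2, by omega⟩
  let σ : Fin (Fintype.card V) ≃ V := Fintype.equivOfCardEq (Fintype.card_fin _)
  let l : V := σ ⟨Fintype.card V - 1, by omega⟩
  have hle : ∀ j ≠ l, a ≤ hA.eigenvalues j := by
    intro j hj
    refine hA.eigenvalues₀_antitone (Fin.le_def.2 ?_)
    have h1 : σ.symm j ≠ ⟨Fintype.card V - 1, by omega⟩ := fun h => hj (σ.symm_apply_eq.1 h)
    have h2 := (σ.symm j).2
    have h3 : (σ.symm j : ℕ) ≠ Fintype.card V - 1 := fun h => h1 (Fin.ext h)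
    change (σ.symm j : ℕ) ≤ Fintype.card V - 2
    omega
  have hone : ∀ j ≠ l, (hA.eigenvectorBasis j).ofLp ⬝ᵥ (fun _ => 1) = 0 := by
    intro j hj
    have h := hA.eigenvectorBasis_dotProduct_mulVec j fun _ => 1
    rw [G.lapMatrix_mulVec_const_eq_zero, dotProduct_zero] at h
    exact (mul_eq_zero.1 h.symm).resolve_left (hpos.trans_le (hle j hj)).ne'
  have hsingle : ∀ y : V → ℝ, ((hA.eigenvectorBasis l).ofLp ⬝ᵥ (fun _ => 1)) *
      ((hA.eigenvectorBasis l).ofLp ⬝ᵥ y) = ∑ v, y v := by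
    intro y
    have h := hA.sum_dotProduct_eigenvectorBasis (fun _ => 1) y
    rw [Finset.sum_eq_single l (fun j _ hj => by rw [hone j hj, zero_mul])
      fun h => (h (Finset.mem_univ _)).elim] at h
    rw [h]
    simp [dotProduct]
  have hxl : (hA.eigenvectorBasis l).ofLp ⬝ᵥ x = 0 := by
    refine (mul_eq_zero.1 ((hsingle x).trans hx)).resolve_left fun h0 => ?_
    have h := hsingle fun _ => 1
    rw [h0, zero_mul] at h
    simp only [Finset.sum_const, Finset.card_univ, nsmul_eq_mul, mul_one] at h
    have : Fintype.card V = 0 := by exact_mod_cast h.symm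
    omega
  have hsq : ∑ v, x v ^ 2 = ∑ j, ((hA.eigenvectorBasis j).ofLp ⬝ᵥ x) ^ 2 := by
    simp only [pow_two, hA.sum_dotProduct_eigenvectorBasis]
    rfl
  rw [← G.dotProduct_lapMatrix_mulVec, hA.dotProduct_mulVec_eq_sum, hsq, Finset.mul_sum]
  refine Finset.sum_le_sum fun j _ => ?_
  by_cases hj : j = l
  · simp [hj, hxl]
  · exact mul_le_mul_of_nonneg_right (hle j hj) (sq_nonneg _)

/-- Courant–Fischer: the plane of the two lowest eigenvectors contains a nonzero vector of sum zero,
whose Rayleigh quotient is at most the larger of the two eigenvalues. -/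
theorem SimpleGraph.le_algebraicConnectivity {V : Type u} [Fintype V]
    (G : SimpleGraph V) [Fintype G.Dart] (hcard : 2 ≤ Fintype.card V) {c : ℝ}
    (h : ∀ x : V → ℝ, ∑ v, x v = 0 →
      c * ∑ v, x v ^ 2 ≤ (∑ d : G.Dart, (x d.fst - x d.snd) ^ 2) / 2) :
    c ≤ G.algebraicConnectivity := by
  classical
  unfold SimpleGraph.algebraicConnectivity
  rw [dif_pos hcard]
  set hA := G.isHermitian_lapMatrix ℝ
  let σ : Fin (Fintype.card V) ≃ V := Fintype.equivOfCardEq (Fintype.card_fin _)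
  let l : V := σ ⟨Fintype.card V - 1, by omega⟩
  let p : V := σ ⟨Fintype.card V - 2, by omega⟩
  have hpl : p ≠ l := by
    intro hpl
    have := Fin.mk.inj_iff.1 (σ.injective hpl)
    omega
  have hp : hA.eigenvalues p = hA.eigenvalues₀ ⟨Fintype.card V - 2, by omega⟩ :=
    congrArg hA.eigenvalues₀ (σ.symm_apply_apply _)
  have hl : hA.eigenvalues l = hA.eigenvalues₀ ⟨Fintype.card V - 1, by omega⟩ :=
    congrArg hA.eigenvalues₀ (σ.symm_apply_apply _)
  have hlp : hA.eigenvalues l ≤ hA.eigenvalues p := by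
    rw [hp, hl]
    exact hA.eigenvalues₀_antitone (Fin.le_def.2 (Nat.sub_le_sub_left (by norm_num) _))
  rw [← hp]
  let u := (hA.eigenvectorBasis p).ofLp
  let w := (hA.eigenvectorBasis l).ofLp
  obtain ⟨α, β, hpos, hsum⟩ : ∃ α β : ℝ, 0 < α ^ 2 + β ^ 2 ∧
      α * ∑ v, u v + β * ∑ v, w v = 0 := by
    by_cases hu : ∑ v, u v = 0
    · exact ⟨1, 0, by norm_num, by rw [hu]; ring⟩
    · exact ⟨∑ v, w v, -∑ v, u v,
        add_pos_of_nonneg_of_pos (sq_nonneg _) (by rw [neg_sq]; positivity), by ring⟩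
  let x : V → ℝ := α • u + β • w
  have hx : ∑ v, x v = 0 := by
    simpa [x, Finset.sum_add_distrib, ← Finset.mul_sum] using hsum
  have hcoef : ∀ j, (hA.eigenvectorBasis j).ofLp ⬝ᵥ x =
      α * (if j = p then 1 else 0) + β * (if j = l then 1 else 0) := by
    intro j
    simp only [x, u, w, dotProduct_add, dotProduct_smul, hA.eigenvectorBasis_dotProduct,
      smul_eq_mul]
  have hweighted : ∀ f : V → ℝ, ∑ j, f j * ((hA.eigenvectorBasis j).ofLp ⬝ᵥ x) ^ 2 =
      f p * α ^ 2 + f l * β ^ 2 := by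
    intro f
    have : ∀ j, f j * ((hA.eigenvectorBasis j).ofLp ⬝ᵥ x) ^ 2 =
        (if j = p then f p * α ^ 2 else 0) + (if j = l then f l * β ^ 2 else 0) := by
      intro j
      rw [hcoef]
      by_cases h1 : j = p
      · subst h1
        simp [hpl]
      · by_cases h2 : j = l
        · subst h2
          simp [h1]
        · simp [h1, h2]
    simp [this, Finset.sum_add_distrib]
  have hsq : ∑ v, x v ^ 2 = α ^ 2 + β ^ 2 := by
    have h1 := hweighted fun _ => 1
    simp only [one_mul, pow_two, hA.sum_dotProduct_eigenvectorBasis] at h1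
    simpa only [pow_two, dotProduct] using h1
  have hmain := h x hx
  rw [← G.dotProduct_lapMatrix_mulVec, hA.dotProduct_mulVec_eq_sum, hweighted, hsq] at hmain
  refine le_of_mul_le_mul_right (hmain.trans ?_) hpos
  nlinarith [mul_le_mul_of_nonneg_right hlp (sq_nonneg β)]

/-! ### Initial bounds, and degrees at least two -/

theorem SimpleGraph.degreePoincare_of_mul_le {V : Type u} [Fintype V] (G : SimpleGraph V)
    [DecidableRel G.Adj] {c : ℝ} (hc : 0 ≤ c) (h : c * G.maxDegree ≤ G.algebraicConnectivity)
    (hcard : 2 ≤ Fintype.card V) : G.DegreePoincare c := by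
  obtain rfl : ‹DecidableRel G.Adj› = fun _ _ => Classical.propDecidable _ := Subsingleton.elim _ _
  classical
  intro x
  set m := (∑ v, x v) / Fintype.card V with hm
  refine ⟨m, ?_⟩
  have hn : (Fintype.card V : ℝ) ≠ 0 := by positivity
  have h0 : ∑ v, (x v - m) = 0 := by
    simp only [Finset.sum_sub_distrib, Finset.sum_const, Finset.card_univ, nsmul_eq_mul, hm]
    field_simp
    ring
  have h1 := G.sum_sq_le_of_algebraicConnectivity (fun v => x v - m) h0
  simp only [sub_sub_sub_cancel_right] at h1
  refine le_trans ?_ h1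
  rw [G.sum_dart_fst fun v => (x v - m) ^ 2]
  calc c * ∑ v, (G.degree v : ℝ) * (x v - m) ^ 2
      ≤ c * ∑ v, (G.maxDegree : ℝ) * (x v - m) ^ 2 := by
        gcongr with v
        exact_mod_cast G.degree_le_maxDegree v
    _ = c * G.maxDegree * ∑ v, (x v - m) ^ 2 := by rw [← Finset.mul_sum, mul_assoc]
    _ ≤ _ := by gcongr

theorem SimpleGraph.algebraicConnectivity_nonneg {V : Type u} [Fintype V] (G : SimpleGraph V) :
    0 ≤ G.algebraicConnectivity := by
  classical
  by_cases hcard : 2 ≤ Fintype.card V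
  · exact G.le_algebraicConnectivity hcard fun x _ => by rw [zero_mul]; positivity
  · simp [SimpleGraph.algebraicConnectivity, hcard]

/-- Any nonzero test vector of sum zero works, by `(p - q)² ≤ 2(p² + q²)`. -/
theorem SimpleGraph.algebraicConnectivity_le_two_mul_maxDegree {V : Type u} [Fintype V]
    (G : SimpleGraph V) [DecidableRel G.Adj] (hcard : 2 ≤ Fintype.card V) :
    G.algebraicConnectivity ≤ 2 * G.maxDegree := by
  classical
  obtain ⟨u, w, huw⟩ := Fintype.exists_pair_of_one_lt_card hcard
  let x : V → ℝ := Pi.single u 1 - Pi.single w 1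
  have hx : ∑ v, x v = 0 := by simp [x]
  have hpos : 0 < ∑ v, x v ^ 2 :=
    Finset.sum_pos' (fun v _ => sq_nonneg _) ⟨u, Finset.mem_univ _, by simp [x, huw]⟩
  refine le_of_mul_le_mul_right ((G.sum_sq_le_of_algebraicConnectivity x hx).trans ?_) hpos
  have hs : ∑ d : G.Dart, x d.snd ^ 2 = ∑ d : G.Dart, x d.fst ^ 2 :=
    G.sum_dart_symm fun d => x d.fst ^ 2
  have h1 : ∑ d : G.Dart, (x d.fst - x d.snd) ^ 2 ≤
      ∑ d : G.Dart, 2 * (x d.fst ^ 2 + x d.snd ^ 2) := by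
    gcongr with d
    nlinarith [sq_nonneg (x d.fst + x d.snd)]
  rw [← Finset.mul_sum, Finset.sum_add_distrib, hs, G.sum_dart_fst fun v => x v ^ 2] at h1
  have h2 : ∑ v, (G.degree v : ℝ) * x v ^ 2 ≤ G.maxDegree * ∑ v, x v ^ 2 := by
    rw [Finset.mul_sum]
    gcongr with v
    exact_mod_cast G.degree_le_maxDegree v
  linarith

/-- Summing a nonnegative function over the starting vertices of all darts gives at least twice its
sum over all vertices; equivalently, all degrees are at least two. -/
def SimpleGraph.DegreesGeTwo {V : Type u} [Fintype V] (G : SimpleGraph V) : Prop :=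
  open Classical in
  ∀ g : V → ℝ, (∀ v, 0 ≤ g v) → 2 * ∑ v, g v ≤ ∑ d : G.Dart, g d.fst

theorem SimpleGraph.degreesGeTwo_of_minDegree {V : Type u} [Fintype V] (G : SimpleGraph V)
    [DecidableRel G.Adj] (h : 2 ≤ G.minDegree) : G.DegreesGeTwo := by
  obtain rfl : ‹DecidableRel G.Adj› = fun _ _ => Classical.propDecidable _ := Subsingleton.elim _ _
  classical
  intro g hg
  rw [G.sum_dart_fst g, Finset.mul_sum]
  refine Finset.sum_le_sum fun v _ => mul_le_mul_of_nonneg_right ?_ (hg v)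
  have h2 := h.trans (G.minDegree_le_degree v)
  exact_mod_cast h2

/-- Old vertices keep their degree and new ones have degree exactly two. -/
theorem SimpleGraph.DegreesGeTwo.subdivision {V : Type u} [Fintype V] {G : SimpleGraph V}
    [Fintype (V ⊕ G.edgeSet)] (h : G.DegreesGeTwo) : G.subdivision.DegreesGeTwo := by
  classical
  intro g hg
  have h1 := h (fun v => g (Sum.inl v)) fun v => hg _
  have h2 := G.sum_dart_edge fun e => g (Sum.inr e)
  rw [G.sum_dart_subdivision fun p _ => g p, h2]
  have h3 : ∑ p, g p = ∑ v, g (Sum.inl v) + ∑ e, g (Sum.inr e) := by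
    rw [← Fintype.sum_sum_type]
    congr!
  rw [h3]
  linarith

theorem SimpleGraph.DegreePoincare.two_mul_le {V : Type u} [Fintype V] {G : SimpleGraph V}
    {c : ℝ} (hc : 0 ≤ c) (h : G.DegreePoincare c) (hdeg : G.DegreesGeTwo)
    (hcard : 2 ≤ Fintype.card V) : 2 * c ≤ G.algebraicConnectivity := by
  classical
  refine G.le_algebraicConnectivity hcard fun x hx => ?_
  obtain ⟨m, hm⟩ := h x
  refine le_trans ?_ hm
  have h1 := hdeg (fun v => (x v - m) ^ 2) fun v => sq_nonneg _
  -- Since `x` has mean zero, recentring at `m` can only increase the sum of squares.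
  have h2 : ∑ v, x v ^ 2 ≤ ∑ v, (x v - m) ^ 2 := by
    have : ∑ v, (x v - m) ^ 2 = ∑ v, x v ^ 2 - 2 * m * ∑ v, x v + ∑ _v : V, m ^ 2 := by
      rw [Finset.mul_sum, ← Finset.sum_sub_distrib, ← Finset.sum_add_distrib]
      exact Finset.sum_congr rfl fun v _ => by ring
    rw [this, hx]
    have : 0 ≤ ∑ _v : V, m ^ 2 := by positivity
    linarith
  calc 2 * c * ∑ v, x v ^ 2 = c * (2 * ∑ v, x v ^ 2) := by ring
    _ ≤ _ := mul_le_mul_of_nonneg_left (by linarith) hc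

/-! ### Iteration and conclusion -/

theorem FiniteGraph.iteratedSubdivision_invariants (G : FiniteGraph.{u}) {c : ℝ} (hc0 : 0 ≤ c)
    (hc2 : c ≤ 2) (hcard : 2 ≤ Fintype.card G.V) (hdeg : G.graph.DegreesGeTwo)
    (hP : G.graph.DegreePoincare c) (k : ℕ) :
    2 ≤ Fintype.card (G.iteratedSubdivision k).V ∧
      (G.iteratedSubdivision k).graph.DegreesGeTwo ∧
      (G.iteratedSubdivision k).graph.DegreePoincare (c / 4 ^ k) := by
  induction k with
  | zero => simpa [FiniteGraph.iteratedSubdivision] using ⟨hcard, hdeg, hP⟩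
  | succ k ih =>
    obtain ⟨h1, h2, h3⟩ := ih
    have hle : c / 4 ^ k ≤ 2 :=
      (div_le_self hc0 (one_le_pow₀ (by norm_num))).trans hc2
    let : Fintype ((G.iteratedSubdivision k).V ⊕ (G.iteratedSubdivision k).graph.edgeSet) :=
      (G.iteratedSubdivision (k + 1)).fintypeV
    refine ⟨?_, h2.subdivision, ?_⟩
    · exact h1.trans (Fintype.card_le_of_injective
        (Sum.inl : _ → _ ⊕ (G.iteratedSubdivision k).graph.edgeSet) Sum.inl_injective)
    · rw [pow_succ, ← div_div]
      exact h3.subdivision (by positivity) hle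

theorem proposition4p5 {V : Type u} [Fintype V] (G : SimpleGraph V) [DecidableRel G.Adj]
    (hconn : G.Connected) (hmin : 2 ≤ G.minDegree) (k : ℕ) :
    min (2 / (G.maxDegree : ℝ) * G.algebraicConnectivity) 8 / 4 ^ k ≤
      ((FiniteGraph.mk V G).iteratedSubdivision k).graph.algebraicConnectivity := by
  obtain ⟨v⟩ := hconn.nonempty
  have hd := hmin.trans (G.minDegree_le_degree v)
  have hcard : 2 ≤ Fintype.card V := hd.trans (G.degree_lt_card_verts v).le
  have hΔ : (0 : ℝ) < G.maxDegree := by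
    exact_mod_cast (by norm_num : 0 < 2).trans_le (hd.trans (G.degree_le_maxDegree v))
  have hc0 : 0 ≤ G.algebraicConnectivity / G.maxDegree :=
    div_nonneg G.algebraicConnectivity_nonneg hΔ.le
  have hc2 : G.algebraicConnectivity / G.maxDegree ≤ 2 :=
    (div_le_iff₀ hΔ).2 (G.algebraicConnectivity_le_two_mul_maxDegree hcard)
  have hP := G.degreePoincare_of_mul_le hc0 (div_mul_cancel₀ _ hΔ.ne').le hcard
  obtain ⟨h1, h2, h3⟩ := (FiniteGraph.mk V G).iteratedSubdivision_invariants hc0 hc2 hcard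
    (G.degreesGeTwo_of_minDegree hmin) hP k
  refine le_trans ?_ (h3.two_mul_le (by positivity) h2 h1)
  rw [← mul_div_assoc]
  gcongr
  -- The cap `8` is never active: `hc2` gives `2a(G)/Δ ≤ 4`.
  exact (min_le_left _ _).trans (le_of_eq (by ring))
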